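/- Let $\varphi:\mathbb{R}^n\to(-\infty,\infty]$, let $\bar x$ satisfy $\varphi(\bar x)<\infty$, let $Q\subseteq\mathbb{R}^m$ be nonempty, closed and convex with support function $\sigma_Q(y)=\sup_{\lambda\in Q}\langle\lambda,y\rangle$, and let $\bar\lambda\in Q$. Suppose that $\varphi$ is $C^2$-strictly decomposable at $\bar x$ for $\bar\lambda$ with decomposition pair $(\sigma_Q,F)$. This means that there is an open neighborhood $U$ of $\bar x$ such that $F:U\to\mathbb{R}^m$ is twice continuously differentiable on $U$, $F(\bar x)=0$, $\varphi(x)=\varphi(\bar x)+\sigma_Q(F(x))$ for all $x\in U$, $$0\in\operatorname{int}\{DF(\bar x)\mathbb{R}^n-\operatorname{dom}\sigma_Q\}\qquad\text{and}\qquad DF(\bar x)\mathbb{R}^n-N_Q(\bar\lambda)=\mathbb{R}^m,$$ where $\operatorname{dom}\sigma_Q=\{y:\sigma_Q(y)<\infty\}$ and $N_Q(\bar\lambda)$ is the normal cone of $Q$ at $\bar\lambda$, i.e. the polar of the tangent cone of $Q$ at $\bar\lambda$. For a function $\theta:\mathbb{R}^d\to(-\infty,\infty]$ and $x$ with $\theta(x)<\infty$,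 the regular subdifferential is $\hat\partial\theta(x)=\{v:\theta(y)\ge\theta(x)+\langle v,y-x\rangle+o(\|y-x\|)\text{ as }y\to x\}$, and the subdifferential $\partial\theta(x)$ is the set of all limits of sequences $v^k\in\hat\partial\theta(y^k)$ with $y^k\to x$ and $\theta(y^k)\to\theta(x)$; both are empty if $\theta(x)=\infty$. The strict second subderivative of $\theta$ at $x$ for $v$ in the direction $h$ is $$d^2_s\theta(x|v)(h)=\liminf_{\substack{t\downarrow0,\ \tilde h\to h,\ \theta(x')\to\theta(x)\\ (x',v')\to(x,v),\ v'\in\partial\theta(x')}}\frac{\theta(x'+t\tilde h)-\theta(x')-t\langle v',\tilde h\rangle}{\tfrac12t^2}\in[-\infty,\infty].$$ Then for every $h\in\mathbb{R}^n$, $$d^2_s\varphi(\bar x|DF(\bar x)^\top\bar\lambda)(h)\ \ge\ d^2_s\sigma_Q(0|\bar\lambda)(DF(\bar x)h)+\langle\bar\lambda,D^2F(\bar x)[h,h]\rangle.$$ Moreover, if $DF(\bar x)h$ belongs to the affine hull of $N_Q(\bar\lambda)$, then this holds with equality and $d^2_s\sigma_Q(0|\bar\lambda)(DF(\bar x)h)=0$.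 -/

import Mathlib

open Filter Topology Set
open scoped Pointwise

noncomputable section

namespace StrictChain

variable {E : Type*} [NormedAddCommGroup E] [InnerProductSpace ℝ E]
variable {E' : Type*} [NormedAddCommGroup E'] [InnerProductSpace ℝ E']

/-- The effective domain `{x | θ x < ∞}` of an extended real-valued function. -/
def dom (θ : E → EReal) : Set E := {x | θ x < ⊤}

/-- The support function `σ_Q(y) = sup_{l ∈ Q} ⟨l, y⟩`. -/
def supportFun (Q : Set E) (y : E) : EReal :=
  ⨆ l ∈ Q, ((inner ℝ l y : ℝ) : EReal)

/-- The polar cone of a set. -/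
def polar (C : Set E) : Set E := {v | ∀ w ∈ C, (inner ℝ v w : ℝ) ≤ 0}

/-- The normal cone of a convex set `C` at `x ∈ C`, i.e. the polar of the (Bouligand) tangent
cone `limsup_{t ↓ 0} (C - x) / t`, which is Mathlib's `posTangentConeAt`. -/
def normalCone (C : Set E) (x : E) : Set E := polar (posTangentConeAt C x)

/-- The regular subdifferential of `θ` at `x` (empty when `x` is outside the effective domain):
all `v` with `θ y ≥ θ x + ⟨v, y - x⟩ + o(‖y - x‖)` as `y → x`. -/
def regularSubdiff (θ : E → EReal) (x : E) : Set E :=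
  {v | x ∈ dom θ ∧ ∀ ε : ℝ, 0 < ε → ∀ᶠ y in 𝓝 x,
    θ x + ((inner ℝ v (y - x) - ε * ‖y - x‖ : ℝ) : EReal) ≤ θ y}

/-- The (limiting) subdifferential of `θ` at `x` (empty when `x` is outside the effective
domain): all limits of regular subgradients `v k` of `θ` at points `y k`, where `y k → x` and
`θ (y k) → θ x`. -/
def subdiff (θ : E → EReal) (x : E) : Set E :=
  {v | x ∈ dom θ ∧ ∃ y w : ℕ → E, Tendsto y atTop (𝓝 x) ∧
    Tendsto (fun k => θ (y k)) atTop (𝓝 (θ x)) ∧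
    (∀ k, w k ∈ regularSubdiff θ (y k)) ∧ Tendsto w atTop (𝓝 v)}

/-- The graph of the subdifferential mapping. -/
def gphSubdiff (θ : E → EReal) : Set (E × E) := {p | p.2 ∈ subdiff θ p.1}

/-- The second-order difference quotient
`(θ(x + t h) - θ(x) - t ⟨v, h⟩) / (t² / 2)`. -/
def secondDiffQuot (θ : E → EReal) (t : ℝ) (x v h : E) : EReal :=
  (θ (x + t • h) - θ x - ((t * inner ℝ v h : ℝ) : EReal)) / ((t ^ 2 / 2 : ℝ) : EReal)

/-- The strict second subderivative of `θ` at `xbar` for `vbar` in the direction `h`: the lower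
limit of the second-order difference quotients as `t ↓ 0`, `h' → h`, and `(x, v) → (xbar, vbar)`
within the graph of the subdifferential with `θ x → θ xbar`. -/
def strictSecondSubderiv (θ : E → EReal) (xbar vbar h : E) : EReal :=
  liminf (fun p : ℝ × E × (E × E) => secondDiffQuot θ p.1 p.2.2.1 p.2.2.2 p.2.1)
    (𝓝[>] (0 : ℝ) ×ˢ (𝓝 h ×ˢ
      (𝓝[gphSubdiff θ] (xbar, vbar) ⊓ comap (fun q : E × E => θ q.1) (𝓝 (θ xbar)))))

/-- `φ : E → (-∞, ∞]` is `C^ℓ`-decomposable at `xbar` with decomposition pair `(σ_Q, F)`. -/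
structure IsDecomposable (ℓ : ℕ) (φ : E → EReal) (xbar : E) (Q : Set E') (F : E → E') :
    Prop where
  ne_bot : ∀ x, φ x ≠ ⊥
  mem_dom : xbar ∈ dom φ
  nonempty : Q.Nonempty
  closed : IsClosed Q
  convex : Convex ℝ Q
  decomp : ∃ U : Set E, IsOpen U ∧ xbar ∈ U ∧ ContDiffOn ℝ ℓ F U ∧
    ∀ x ∈ U, φ x = φ xbar + supportFun Q (F x)
  map_zero : F xbar = 0
  /-- Robinson's constraint qualification. -/
  robinson : (0 : E') ∈ interior ({F xbar} + range (fderiv ℝ F xbar) - dom (supportFun Q))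

/-- `φ` is `C^ℓ`-strictly decomposable at `xbar` for `lbar ∈ Q` with decomposition pair
`(σ_Q, F)`. -/
structure IsStrictlyDecomposable (ℓ : ℕ) (φ : E → EReal) (xbar : E) (Q : Set E') (F : E → E')
    (lbar : E') : Prop extends IsDecomposable ℓ φ xbar Q F where
  mem : lbar ∈ Q
  strict : range (fderiv ℝ F xbar) - normalCone Q lbar = univ

end StrictChain

end

/-! Write `A` for the derivative of `F` at `xbar`. Near the reference point of the graph of the
subdifferential of `φ`, every subgradient at `x` is the adjoint derivative at `x` applied to some `l
∈ Q` that maximizes the pairing with `F x`. The condition `strict` gives a linear error bound on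
`Q`, which forces such `l` to approach `lbar` (`exists_multiplier`). The difference quotient of `φ`
then splits exactly into a quotient of `σ_Q` at `(F x, l)` and a Taylor remainder paired with `l`
(`secondDiffQuot_comp`). The remainder converges even though the base point moves, so taking lower
limits gives the inequality.

For equality, two curves with relative velocity `h` are built along which `F` stays in the normal
cone at `lbar` (`exists_curves_mem_polar`). There `σ_Q` coincides with the linear form of `lbar`, so
its quotient vanishes and the subderivative of `φ` is at most the curvature term. By convexity the
subderivative of `σ_Q` is nonnegative, so the two bounds close up and it must be zero. -/

namespace StrictChain

/-! ### Polar cones, support functions and their Moreau envelopes. -/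

section ConvexAnalysis

variable {E : Type*} [NormedAddCommGroup E] [InnerProductSpace ℝ E]
variable {E' : Type*} [NormedAddCommGroup E'] [InnerProductSpace ℝ E']

theorem zero_mem_polar (C : Set E) : (0 : E) ∈ polar C := fun w _ => by simp

theorem add_mem_polar {C : Set E} {v w : E} (hv : v ∈ polar C) (hw : w ∈ polar C) :
    v + w ∈ polar C := fun z hz => by
  rw [inner_add_left]; exact add_nonpos (hv z hz) (hw z hz)

theorem smul_mem_polar {C : Set E} {v : E} {t : ℝ} (ht : 0 ≤ t) (hv : v ∈ polar C) :
    t • v ∈ polar C := fun z hz => by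
  rw [real_inner_smul_left]; exact mul_nonpos_of_nonneg_of_nonpos ht (hv z hz)

theorem convex_polar (C : Set E) : Convex ℝ (polar C) := fun _ hv _ hw _ _ ha hb _ =>
  add_mem_polar (smul_mem_polar ha hv) (smul_mem_polar hb hw)

theorem inner_sub_nonpos_of_mem_normalCone {Q : Set E} (hQ : Convex ℝ Q) {l : E} (hl : l ∈ Q)
    {v : E} (hv : v ∈ normalCone Q l) {k : E} (hk : k ∈ Q) : (inner ℝ v (k - l) : ℝ) ≤ 0 :=
  hv _ (sub_mem_posTangentConeAt_of_segment_subset (hQ.segment_subset hl hk))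

theorem inner_le_of_mem_normalCone {Q : Set E} (hQ : Convex ℝ Q) {l : E} (hl : l ∈ Q)
    {v : E} (hv : v ∈ normalCone Q l) {k : E} (hk : k ∈ Q) :
    (inner ℝ k v : ℝ) ≤ inner ℝ l v := by
  have h := inner_sub_nonpos_of_mem_normalCone hQ hl hv hk
  rw [real_inner_comm, inner_sub_left] at h
  linarith

theorem le_supportFun {Q : Set E} {l : E} (hl : l ∈ Q) (y : E) :
    ((inner ℝ l y : ℝ) : EReal) ≤ supportFun Q y :=
  le_iSup₂ (f := fun l (_ : l ∈ Q) => ((inner ℝ l y : ℝ) : EReal)) l hl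

theorem supportFun_le {Q : Set E} {y : E} {a : EReal}
    (h : ∀ l ∈ Q, ((inner ℝ l y : ℝ) : EReal) ≤ a) : supportFun Q y ≤ a :=
  iSup₂_le h

theorem supportFun_eq_of_forall_le {Q : Set E} {l y : E} (hl : l ∈ Q)
    (h : ∀ k ∈ Q, (inner ℝ k y : ℝ) ≤ inner ℝ l y) :
    supportFun Q y = ((inner ℝ l y : ℝ) : EReal) :=
  le_antisymm (supportFun_le fun k hk => EReal.coe_le_coe_iff.2 (h k hk)) (le_supportFun hl y)

theorem supportFun_ne_bot {Q : Set E} (hQ : Q.Nonempty) (y : E) : supportFun Q y ≠ ⊥ := by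
  obtain ⟨l, hl⟩ := hQ
  exact ne_bot_of_le_ne_bot (EReal.coe_ne_bot _) (le_supportFun hl y)

theorem supportFun_zero {Q : Set E} (hQ : Q.Nonempty) : supportFun Q 0 = 0 := by
  obtain ⟨l, hl⟩ := hQ
  rw [supportFun_eq_of_forall_le hl (by simp)]
  simp

theorem regularSubdiff_subset_subdiff (θ : E → EReal) (x : E) :
    regularSubdiff θ x ⊆ subdiff θ x := fun v hv =>
  ⟨hv.1, fun _ => x, fun _ => v, tendsto_const_nhds, tendsto_const_nhds, fun _ => hv,
    tendsto_const_nhds⟩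

theorem mem_subdiff_supportFun {Q : Set E} {l y : E} (hl : l ∈ Q)
    (h : ∀ k ∈ Q, (inner ℝ k y : ℝ) ≤ inner ℝ l y) : l ∈ subdiff (supportFun Q) y := by
  refine regularSubdiff_subset_subdiff _ _ ⟨?_, fun ε hε => Eventually.of_forall fun z => ?_⟩
  · change supportFun Q y < ⊤
    rw [supportFun_eq_of_forall_le hl h]
    exact EReal.coe_lt_top _
  · rw [supportFun_eq_of_forall_le hl h, ← EReal.coe_add]
    refine le_trans (EReal.coe_le_coe_iff.2 ?_) (le_supportFun hl z)
    rw [inner_sub_right]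
    have := mul_nonneg hε.le (norm_nonneg (z - y))
    linarith

/-- Subgradients of a support function satisfy the global subgradient inequality. -/
theorem le_supportFun_of_mem_regularSubdiff {Q : Set E} (hQ : Q.Nonempty) {y v : E}
    (hv : v ∈ regularSubdiff (supportFun Q) y) (z : E) :
    supportFun Q y + ((inner ℝ v (z - y) : ℝ) : EReal) ≤ supportFun Q z := by
  obtain ⟨hdom, hv⟩ := hv
  obtain ⟨s, hs⟩ : ∃ s : ℝ, supportFun Q y = s :=
    ⟨_, (EReal.coe_toReal hdom.ne (supportFun_ne_bot hQ y)).symm⟩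
  rcases eq_or_ne (supportFun Q z) ⊤ with hz | hz
  · rw [hz]; exact le_top
  obtain ⟨r, hr⟩ : ∃ r : ℝ, supportFun Q z = r :=
    ⟨_, (EReal.coe_toReal hz (supportFun_ne_bot hQ z)).symm⟩
  rw [hs, hr, ← EReal.coe_add, EReal.coe_le_coe_iff]
  refine le_of_forall_pos_le_add fun δ hδ => ?_
  set ε : ℝ := δ / (‖z - y‖ + 1) with hε
  have hn : (0 : ℝ) < ‖z - y‖ + 1 := by positivity
  have hε0 : 0 < ε := by positivity
  have hlim : Tendsto (fun t : ℝ => y + t • (z - y)) (𝓝[>] 0) (𝓝 y) := by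
    have : Continuous fun t : ℝ => y + t • (z - y) := by fun_prop
    simpa using (this.tendsto 0).mono_left nhdsWithin_le_nhds
  have h1 : ∀ᶠ t : ℝ in 𝓝[>] 0, t ≤ 1 :=
    nhdsWithin_le_nhds (eventually_le_nhds zero_lt_one)
  obtain ⟨t, ht, ht1, ht0⟩ :=
    ((hlim.eventually (hv ε hε0)).and (h1.and self_mem_nhdsWithin)).exists
  have ht0 : 0 < t := ht0
  -- Convexity of the support function on the segment, checked one linear form at a time; it turns
  -- the local inequality into a global one.
  have hub : supportFun Q (y + t • (z - y)) ≤ (((1 - t) * s + t * r : ℝ) : EReal) := by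
    refine supportFun_le fun l hl => EReal.coe_le_coe_iff.2 ?_
    have e1 : (inner ℝ l y : ℝ) ≤ s := by
      have := le_supportFun hl y
      rwa [hs, EReal.coe_le_coe_iff] at this
    have e2 : (inner ℝ l z : ℝ) ≤ r := by
      have := le_supportFun hl z
      rwa [hr, EReal.coe_le_coe_iff] at this
    rw [inner_add_right, real_inner_smul_right, inner_sub_right]
    nlinarith
  have h2 := ht.trans hub
  rw [hs, ← EReal.coe_add, EReal.coe_le_coe_iff] at h2
  rw [add_sub_cancel_left, real_inner_smul_right, norm_smul, Real.norm_of_nonneg ht0.le] at h2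
  have h3 : t * (s + inner ℝ v (z - y)) ≤ t * (r + ε * ‖z - y‖) := by nlinarith
  have h4 := le_of_mul_le_mul_left h3 ht0
  have h5 : ε * ‖z - y‖ ≤ δ := by
    rw [hε, div_mul_eq_mul_div, div_le_iff₀ hn]
    nlinarith [norm_nonneg (z - y)]
  linarith

/-- The global inequality survives the limit because values converge along the defining sequence;
the linear term is finite, so addition in `EReal` is continuous there. -/
theorem le_supportFun_of_mem_subdiff {Q : Set E} (hQ : Q.Nonempty) {y v : E}
    (hv : v ∈ subdiff (supportFun Q) y) (z : E) :
    supportFun Q y + ((inner ℝ v (z - y) : ℝ) : EReal) ≤ supportFun Q z := by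
  obtain ⟨hdom, a, w, ha, hθ, hw, hwv⟩ := hv
  have hreal : Tendsto (fun k => ((inner ℝ (w k) (z - a k) : ℝ) : EReal)) atTop
      (𝓝 ((inner ℝ v (z - y) : ℝ) : EReal)) :=
    (continuous_coe_real_ereal.tendsto _).comp (hwv.inner (tendsto_const_nhds.sub ha))
  have hsum := (EReal.continuousAt_add (p := (supportFun Q y, ((inner ℝ v (z - y) : ℝ) : EReal)))
    (Or.inr (EReal.coe_ne_bot _)) (Or.inr (EReal.coe_ne_top _))).tendsto.comp
    (hθ.prodMk_nhds hreal)
  exact le_of_tendsto hsum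
    (Eventually.of_forall fun k => le_supportFun_of_mem_regularSubdiff hQ (hw k) z)

theorem secondDiffQuot_supportFun_nonneg {Q : Set E} (hQ : Q.Nonempty) {y v : E}
    (hv : v ∈ subdiff (supportFun Q) y) (t : ℝ) (h : E) :
    0 ≤ secondDiffQuot (supportFun Q) t y v h := by
  refine EReal.div_nonneg ?_ (EReal.coe_nonneg.2 (by positivity))
  have hsub := le_supportFun_of_mem_subdiff hQ hv (y + t • h)
  obtain ⟨s, hs⟩ : ∃ s : ℝ, supportFun Q y = s :=
    ⟨_, (EReal.coe_toReal hv.1.ne (supportFun_ne_bot hQ y)).symm⟩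
  rw [add_sub_cancel_left, real_inner_smul_right, hs, ← EReal.coe_add] at hsub
  have h1 := EReal.sub_le_sub (EReal.sub_le_sub hsub (le_refl (s : EReal)))
    (le_refl ((t * inner ℝ v h : ℝ) : EReal))
  rw [hs]
  refine le_trans ?_ h1
  rw [← EReal.coe_sub, ← EReal.coe_sub]
  exact EReal.coe_nonneg.2 (by linarith)

theorem strictSecondSubderiv_supportFun_nonneg {Q : Set E} (hQ : Q.Nonempty) (l h : E) :
    0 ≤ strictSecondSubderiv (supportFun Q) 0 l h := by
  refine le_liminf_of_le (by isBoundedDefault) ?_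
  have h1 : ∀ᶠ q : E × E in 𝓝[gphSubdiff (supportFun Q)] ((0 : E), l) ⊓
      comap (fun q : E × E => supportFun Q q.1) (𝓝 (supportFun Q 0)),
      q ∈ gphSubdiff (supportFun Q) :=
    mem_inf_of_left self_mem_nhdsWithin
  filter_upwards [(h1.prod_inr _).prod_inr _] with p hp
  exact secondDiffQuot_supportFun_nonneg hQ hp _ _

/-- The strict qualification condition yields a linear error bound on `Q` for the equation
`A† k = A† l`. -/
theorem exists_norm_sub_le_of_range_sub_normalCone [CompleteSpace E] [FiniteDimensional ℝ E']
    {Q : Set E'} (hQ : Convex ℝ Q)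
    {l : E'} (hl : l ∈ Q) {A : E →L[ℝ] E'} (hA : range A - normalCone Q l = univ) :
    ∃ C : ℝ, 0 ≤ C ∧ ∀ k ∈ Q, ‖k - l‖ ≤ C * ‖ContinuousLinearMap.adjoint A (k - l)‖ := by
  -- Decompose `e = A u - ν` with `ν` normal at `l`: the `ν` part has a favourable sign, and the `A
  -- u` part is moved onto the adjoint.
  have key : ∀ e : E', ∃ c : ℝ, 0 ≤ c ∧ ∀ k ∈ Q,
      -(inner ℝ e (k - l) : ℝ) ≤ c * ‖ContinuousLinearMap.adjoint A (k - l)‖ := by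
    intro e
    obtain ⟨_, ⟨u, rfl⟩, ν, hν, he⟩ := mem_sub.1 (hA.symm ▸ mem_univ e)
    refine ⟨‖u‖, norm_nonneg _, fun k hk => ?_⟩
    have h1 := inner_sub_nonpos_of_mem_normalCone hQ hl hν hk
    have h2 := neg_le_of_abs_le (abs_real_inner_le_norm u (ContinuousLinearMap.adjoint A (k - l)))
    rw [ContinuousLinearMap.adjoint_inner_right] at h2
    rw [← he, inner_sub_left]
    linarith
  choose c hc0 hc using key
  let b := stdOrthonormalBasis ℝ E'
  -- Using both `b i` and `-(b i)` makes the one-sided estimates two-sided, coordinate by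
  -- coordinate.
  refine ⟨∑ i, (c (b i) + c (-(b i))), Finset.sum_nonneg fun i _ => add_nonneg (hc0 _) (hc0 _),
    fun k hk => ?_⟩
  calc ‖k - l‖ = ‖∑ i, (inner ℝ (b i) (k - l) : ℝ) • b i‖ := by rw [b.sum_repr']
    _ ≤ ∑ i, ‖(inner ℝ (b i) (k - l) : ℝ) • b i‖ := norm_sum_le _ _
    _ ≤ ∑ i, (c (b i) + c (-(b i))) * ‖ContinuousLinearMap.adjoint A (k - l)‖ := by
        refine Finset.sum_le_sum fun i _ => ?_
        rw [norm_smul, b.norm_eq_one, mul_one, Real.norm_eq_abs]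
        have h1 := hc (b i) k hk
        have h2 := hc (-(b i)) k hk
        rw [inner_neg_left, neg_neg] at h2
        have h3 := mul_nonneg (hc0 (b i)) (norm_nonneg (ContinuousLinearMap.adjoint A (k - l)))
        have h4 := mul_nonneg (hc0 (-(b i))) (norm_nonneg (ContinuousLinearMap.adjoint A (k - l)))
        rw [abs_le]
        constructor <;> nlinarith
    _ = _ := by rw [Finset.sum_mul]

/-- The regularized support function `sup_{l ∈ Q} ⟨l, z⟩ - ‖l‖² / (2 k)`, which is the Moreau
envelope of the support function, in closed form. -/
noncomputable def moreauSupport (Q : Set E) (k : ℝ) (z : E) : ℝ :=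
  k / 2 * ‖z‖ ^ 2 - Metric.infDist (k • z) Q ^ 2 / (2 * k)

theorem continuous_moreauSupport (Q : Set E) (k : ℝ) : Continuous (moreauSupport Q k) := by
  have h : Continuous fun z : E => Metric.infDist (k • z) Q :=
    (Metric.continuous_infDist_pt Q).comp (continuous_const_smul k)
  unfold moreauSupport
  fun_prop

/-- Completing the square: maximizing the regularized pairing over `Q` amounts to projecting `k • z`
onto `Q`. -/
theorem inner_sub_norm_sq_div {k : ℝ} (hk : 0 < k) (l z : E) :
    (inner ℝ l z : ℝ) - ‖l‖ ^ 2 / (2 * k) = k / 2 * ‖z‖ ^ 2 - ‖k • z - l‖ ^ 2 / (2 * k) := by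
  rw [norm_sub_sq_real, norm_smul, Real.norm_of_nonneg hk.le, real_inner_smul_left,
    real_inner_comm]
  field_simp
  ring

theorem le_moreauSupport {Q : Set E} {k : ℝ} (hk : 0 < k) {l : E} (hl : l ∈ Q) (z : E) :
    (inner ℝ l z : ℝ) - ‖l‖ ^ 2 / (2 * k) ≤ moreauSupport Q k z := by
  rw [inner_sub_norm_sq_div hk, moreauSupport, ← dist_eq_norm]
  have h0 : 0 ≤ Metric.infDist (k • z) Q := Metric.infDist_nonneg
  have h := Metric.infDist_le_dist_of_mem (x := k • z) hl
  gcongr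

/-- The maximizer is the projection of `k • z`. The quadratic upper bound touching at `z` replaces
differentiability of the envelope in the stationarity argument. -/
theorem exists_moreauSupport_eq [ProperSpace E] {Q : Set E} (hne : Q.Nonempty) (hcl : IsClosed Q)
    (hQ : Convex ℝ Q) {k : ℝ} (hk : 0 < k) (z : E) :
    ∃ l ∈ Q, moreauSupport Q k z = (inner ℝ l z : ℝ) - ‖l‖ ^ 2 / (2 * k) ∧
      ∀ z', moreauSupport Q k z' ≤
        moreauSupport Q k z + inner ℝ l (z' - z) + k / 2 * ‖z' - z‖ ^ 2 := by
  obtain ⟨l, hl, hd⟩ := hcl.exists_infDist_eq_dist hne (k • z)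
  have heq : moreauSupport Q k z = (inner ℝ l z : ℝ) - ‖l‖ ^ 2 / (2 * k) := by
    rw [inner_sub_norm_sq_div hk, moreauSupport, hd, dist_eq_norm]
  refine ⟨l, hl, heq, fun z' => ?_⟩
  have hproj : ∀ w ∈ Q, (inner ℝ (k • z - l) (w - l) : ℝ) ≤ 0 := by
    refine (norm_eq_iInf_iff_real_inner_le_zero hQ hl).1 ?_
    rw [← dist_eq_norm, ← hd, Metric.infDist_eq_iInf]
    simp_rw [dist_eq_norm]
  obtain ⟨l', hl', hd'⟩ := hcl.exists_infDist_eq_dist hne (k • z')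
  have heq' : moreauSupport Q k z' = (inner ℝ l' z' : ℝ) - ‖l'‖ ^ 2 / (2 * k) := by
    rw [inner_sub_norm_sq_div hk, moreauSupport, hd', dist_eq_norm]
  rw [heq, heq']
  -- The projection inequality at `l` and the nonnegative square `h2` add up to the claim multiplied
  -- by `2 * k`.
  have h1 := hproj l' hl'
  have h2 : 0 ≤ ‖(l' - l) - k • (z' - z)‖ ^ 2 := sq_nonneg _
  rw [norm_sub_sq_real, norm_smul, Real.norm_of_nonneg hk.le, norm_sub_sq_real l' l] at h2
  simp only [inner_sub_left, inner_sub_right, real_inner_smul_left, real_inner_smul_right,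
    real_inner_self_eq_norm_sq] at h1 h2 ⊢
  rw [real_inner_comm l' z, real_inner_comm l z] at h1
  rw [real_inner_comm l l'] at h2
  have h3 : 0 ≤ ((inner ℝ l z' : ℝ) - ‖l‖ ^ 2 / (2 * k) + k / 2 * ‖z' - z‖ ^ 2
      - (inner ℝ l' z' - ‖l'‖ ^ 2 / (2 * k))) * (2 * k) := by
    have e : ((inner ℝ l z' : ℝ) - ‖l‖ ^ 2 / (2 * k) + k / 2 * ‖z' - z‖ ^ 2
      - (inner ℝ l' z' - ‖l'‖ ^ 2 / (2 * k))) * (2 * k) = 2 * k * inner ℝ l z' - ‖l‖ ^ 2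
        + k ^ 2 * ‖z' - z‖ ^ 2 - 2 * k * inner ℝ l' z' + ‖l'‖ ^ 2 := by
      field_simp
      ring
    rw [e]
    nlinarith
  have h4 := nonneg_of_mul_nonneg_left h3 (by positivity)
  linarith

end ConvexAnalysis

/-! ### Multiplier rules for subgradients of the composition. -/

section MultiplierRule

theorem tendsto_clm_apply {E G : Type*} [NormedAddCommGroup E] [NormedSpace ℝ E]
    [NormedAddCommGroup G] [NormedSpace ℝ G] {α : Type*} {u : Filter α} {T : α → E →L[ℝ] G} {T₀ : E →L[ℝ] G}
    {f : α → E} {x : E}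
    (hT : Tendsto T u (𝓝 T₀)) (hf : Tendsto f u (𝓝 x)) :
    Tendsto (fun a => T a (f a)) u (𝓝 (T₀ x)) :=
  (isBoundedBilinearMap_apply.continuous.tendsto (T₀, x)).comp (hT.prodMk_nhds hf)

variable {E : Type*} [NormedAddCommGroup E] [InnerProductSpace ℝ E]
variable {E' : Type*} [NormedAddCommGroup E'] [InnerProductSpace ℝ E']

/-- Moving along `-v` decreases `G` at rate `‖v‖` per unit length, while the hypothesis allows a
rate of at most `ε`. -/
theorem norm_le_of_hasFDerivAt_of_eventually_le {G : E → ℝ} {v : E} {z : E} {ε : ℝ} (hε : 0 ≤ ε)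
    (hG : HasFDerivAt G (innerSL ℝ v) z)
    (h : ∀ᶠ y in 𝓝 z, G z - ε * ‖y - z‖ ≤ G y) : ‖v‖ ≤ ε := by
  refine le_of_forall_pos_le_add fun δ hδ => ?_
  have hlim : Tendsto (fun t : ℝ => z + t • (-v)) (𝓝[>] 0) (𝓝 z) := by
    have : Continuous fun t : ℝ => z + t • (-v) := by fun_prop
    simpa using (this.tendsto 0).mono_left nhdsWithin_le_nhds
  obtain ⟨t, ⟨h1, h2⟩, ht⟩ :=
    ((hlim.eventually (h.and (hG.isLittleO.def hδ))).and self_mem_nhdsWithin).exists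
  have ht : 0 < t := ht
  rw [add_sub_cancel_left] at h1 h2
  have h3 := le_of_abs_le h2
  rw [innerSL_apply_apply, inner_smul_right, inner_neg_right, real_inner_self_eq_norm_sq] at h3
  rw [norm_smul, norm_neg, Real.norm_of_nonneg ht.le] at h1 h3
  rcases (norm_nonneg v).eq_or_lt with hv | hv
  · rw [← hv]; positivity
  · have h4 : (t * ‖v‖) * ‖v‖ ≤ (t * ‖v‖) * (ε + δ) := by nlinarith
    exact le_of_mul_le_mul_left h4 (by positivity)

variable [FiniteDimensional ℝ E']

theorem moreauSupport_le_of_supportFun_eq {Q : Set E'} (hne : Q.Nonempty) (hcl : IsClosed Q)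
    (hQ : Convex ℝ Q) {k : ℝ} (hk : 0 < k) {z : E'} {s : ℝ} (hs : supportFun Q z = s) :
    moreauSupport Q k z ≤ s := by
  obtain ⟨l, hl, h, -⟩ := exists_moreauSupport_eq hne hcl hQ hk z
  have h1 := le_supportFun hl z
  rw [hs, EReal.coe_le_coe_iff] at h1
  have h2 : 0 ≤ ‖l‖ ^ 2 / (2 * k) := by positivity
  linarith

variable [FiniteDimensional ℝ E]

/-- Stationarity at a local minimizer of the regularized problem. -/
theorem norm_adjoint_sub_le_of_isMin {Q : Set E'} {F : E → E'} {k ε : ℝ} (hε : 0 ≤ ε)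
    {x z v : E} {l : E'} (hF : DifferentiableAt ℝ F z)
    (hl : ∀ w, moreauSupport Q k w ≤
      moreauSupport Q k (F z) + inner ℝ l (w - F z) + k / 2 * ‖w - F z‖ ^ 2)
    (hmin : ∀ᶠ y in 𝓝 z, moreauSupport Q k (F z) - inner ℝ v (z - x) + ε * ‖z - x‖ ≤
      moreauSupport Q k (F y) - inner ℝ v (y - x) + ε * ‖y - x‖) :
    ‖ContinuousLinearMap.adjoint (fderiv ℝ F z) l - v‖ ≤ ε := by
  -- `G` comes from the quadratic majorant of the envelope, which is exact at `z`. It therefore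
  -- inherits approximate minimality at `z`, and it is differentiable there.
  set G : E → ℝ := fun y => (inner ℝ l (F y - F z) : ℝ) + k / 2 * ‖F y - F z‖ ^ 2
    - inner ℝ v (y - z) with hGdef
  have hd := hF.hasFDerivAt.sub_const (F z)
  have hG : HasFDerivAt G (innerSL ℝ (ContinuousLinearMap.adjoint (fderiv ℝ F z) l - v)) z := by
    have h1 := ((hasFDerivAt_const l z).inner ℝ hd).add (hd.norm_sq.const_mul (k / 2))
    have h2 := h1.sub ((hasFDerivAt_const v z).inner ℝ ((hasFDerivAt_id z).sub_const z))
    refine h2.congr_fderiv ?_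
    ext w
    simp [ContinuousLinearMap.adjoint_inner_left]
  refine norm_le_of_hasFDerivAt_of_eventually_le hε hG ?_
  filter_upwards [hmin] with y hy
  have h1 := hl (F y)
  have h2 : ‖y - x‖ ≤ ‖y - z‖ + ‖z - x‖ := by
    simpa using norm_add_le (y - z) (z - x)
  have h3 : (inner ℝ v (y - x) : ℝ) = inner ℝ v (y - z) + inner ℝ v (z - x) := by
    rw [← inner_add_right, sub_add_sub_cancel]
  have h4 := mul_le_mul_of_nonneg_left h2 hε
  simp only [hGdef, sub_self, inner_zero_right, norm_zero]
  nlinarith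

/-- Approximate multiplier rule for regular subgradients of `a + σ_Q ∘ F`. -/
theorem exists_approx_multiplier_of_mem_regularSubdiff {φ : E → EReal} {Q : Set E'} {F : E → E'}
    (hne : Q.Nonempty) (hcl : IsClosed Q) (hQ : Convex ℝ Q) {x v : E} {a C : ℝ}
    (hφ : ∀ᶠ y in 𝓝 x, φ y = a + supportFun Q (F y)) (hF : ContDiffAt ℝ 1 F x)
    (hC : ∀ᶠ y in 𝓝 x, ∀ k ∈ Q,
      ‖k‖ ≤ C * (1 + ‖ContinuousLinearMap.adjoint (fderiv ℝ F y) k‖)) (hC0 : 0 ≤ C)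
    (hv : v ∈ regularSubdiff φ x) {ε : ℝ} (hε : 0 < ε) :
    ∃ l ∈ Q, (∀ k ∈ Q, (inner ℝ k (F x) : ℝ) ≤ inner ℝ l (F x)) ∧
      ‖ContinuousLinearMap.adjoint (fderiv ℝ F x) l - v‖ ≤ ε := by
  obtain ⟨hdom, hv⟩ := hv
  have hφx := hφ.self_of_nhds
  obtain ⟨s, hs⟩ : ∃ s : ℝ, supportFun Q (F x) = s := by
    refine ⟨_, (EReal.coe_toReal ?_ (supportFun_ne_bot hne _)).symm⟩
    intro h
    rw [h, EReal.coe_add_top] at hφx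
    have hlt : φ x < ⊤ := hdom
    exact hlt.ne hφx
  have hdiff : ∀ᶠ y in 𝓝 x, DifferentiableAt ℝ F y :=
    (hF.eventually (by simp)).mono fun y hy => hy.differentiableAt (by simp)
  -- The subgradient inequality is used with `ε / 2` while the penalty below carries `ε`; the gap
  -- pins the limit of the minimizers to `x`.
  obtain ⟨δ, hδ, hball⟩ := Metric.nhds_basis_closedBall.eventually_iff.1
    (((hφ.and hdiff).and hC).and (hv (ε / 2) (half_pos hε)))
  have hxmem : x ∈ Metric.closedBall x δ := Metric.mem_closedBall_self hδ.le
  have hFc : ContinuousOn F (Metric.closedBall x δ) := fun y hy =>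
    (hball hy).1.1.2.continuousAt.continuousWithinAt
  have hcomp : IsCompact (Metric.closedBall x δ) := isCompact_closedBall x δ
  have hmin : ∀ n : ℕ, ∃ z ∈ Metric.closedBall x δ, ∀ y ∈ Metric.closedBall x δ,
      moreauSupport Q (n + 1) (F z) - inner ℝ v (z - x) + ε * ‖z - x‖ ≤
      moreauSupport Q (n + 1) (F y) - inner ℝ v (y - x) + ε * ‖y - x‖ := by
    intro n
    refine hcomp.exists_isMinOn (f := fun y => moreauSupport Q (n + 1 : ℝ) (F y)
      - inner ℝ v (y - x) + ε * ‖y - x‖) ⟨x, hxmem⟩ ?_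
    have h1 : ContinuousOn (fun y => moreauSupport Q (n + 1 : ℝ) (F y))
        (Metric.closedBall x δ) := (continuous_moreauSupport Q _).comp_continuousOn hFc
    fun_prop
  choose z hz hzmin using hmin
  have hpos : ∀ n : ℕ, (0 : ℝ) < n + 1 := fun n => by positivity
  obtain ⟨w, hw, θ, hθ, hlim⟩ := hcomp.tendsto_subseq hz
  have hFw : Tendsto (fun n => F (z (θ n))) atTop (𝓝 (F w)) :=
    (hball hw).1.1.2.continuousAt.tendsto.comp hlim
  have hinv : ∀ c : ℝ, Tendsto (fun n : ℕ => c / (2 * ((θ n : ℝ) + 1))) atTop (𝓝 0) := by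
    intro c
    refine Tendsto.div_atTop tendsto_const_nhds ?_
    refine Tendsto.const_mul_atTop two_pos (tendsto_atTop_add_const_right _ _ ?_)
    exact tendsto_natCast_atTop_atTop.comp hθ.tendsto_atTop
  have hwx : w = x := by
    have h1 : ∀ l ∈ Q, (inner ℝ l (F w) : ℝ) - 0 - inner ℝ v (w - x) + ε * ‖w - x‖ ≤ s := by
      intro l hl
      have hl1 : Tendsto (fun n => (inner ℝ l (F (z (θ n))) : ℝ)
          - ‖l‖ ^ 2 / (2 * ((θ n : ℝ) + 1)) - inner ℝ v (z (θ n) - x) + ε * ‖z (θ n) - x‖) atTop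
          (𝓝 ((inner ℝ l (F w) : ℝ) - 0 - inner ℝ v (w - x) + ε * ‖w - x‖)) :=
        (((tendsto_const_nhds.inner hFw).sub (hinv _)).sub
          (tendsto_const_nhds.inner (hlim.sub_const x))).add ((hlim.sub_const x).norm.const_mul ε)
      refine le_of_tendsto' hl1 fun n => ?_
      have h2 := hzmin (θ n) x hxmem
      have h3 := le_moreauSupport (hpos (θ n)) hl (F (z (θ n)))
      have h4 := moreauSupport_le_of_supportFun_eq hne hcl hQ (hpos (θ n)) hs
      simp only [sub_self, inner_zero_right, norm_zero] at h2
      linarith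
    have h2 : supportFun Q (F w) ≤ ((s + inner ℝ v (w - x) - ε * ‖w - x‖ : ℝ) : EReal) :=
      supportFun_le fun l hl => EReal.coe_le_coe_iff.2 (by linarith [h1 l hl])
    have h3 := (hball hw).2
    rw [(hball hw).1.1.1, hφx, hs] at h3
    have h4 := h3.trans (add_le_add_right h2 _)
    rw [← EReal.coe_add, ← EReal.coe_add, ← EReal.coe_add, EReal.coe_le_coe_iff] at h4
    have h5 : ‖w - x‖ ≤ 0 := by nlinarith
    exact sub_eq_zero.1 (norm_le_zero_iff.1 h5)
  subst hwx
  choose l hlQ hleq hlup using fun n : ℕ =>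
    exists_moreauSupport_eq hne hcl hQ (hpos (θ n)) (F (z (θ n)))
  have hev : ∀ᶠ n in atTop,
      ‖ContinuousLinearMap.adjoint (fderiv ℝ F (z (θ n))) (l n) - v‖ ≤ ε := by
    -- Eventually the minimizers lie in the open ball, so the constraint is inactive and they are
    -- local minimizers.
    filter_upwards [hlim.eventually (Metric.ball_mem_nhds w hδ)] with n hn
    have hn' : Metric.closedBall w δ ∈ 𝓝 (z (θ n)) :=
      mem_of_superset (Metric.isOpen_ball.mem_nhds hn) Metric.ball_subset_closedBall
    exact norm_adjoint_sub_le_of_isMin hε.le (hball (hz (θ n))).1.1.2 (hlup n)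
      (mem_of_superset hn' (hzmin (θ n)))
  have hbdd : ∀ᶠ n in atTop, l n ∈ Metric.closedBall (0 : E') (C * (1 + (‖v‖ + ε))) := by
    filter_upwards [hev] with n hn
    rw [mem_closedBall_zero_iff]
    refine ((hball (hz (θ n))).1.2 (l n) (hlQ n)).trans ?_
    have := norm_le_norm_add_norm_sub' (ContinuousLinearMap.adjoint (fderiv ℝ F (z (θ n))) (l n)) v
    gcongr
    linarith
  obtain ⟨m, -, τ, hτ, hm⟩ := (isCompact_closedBall _ _).tendsto_subseq' hbdd.frequently
  have hmQ : m ∈ Q := hcl.mem_of_tendsto hm (Eventually.of_forall fun n => hlQ _)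
  have hzτ := hlim.comp hτ.tendsto_atTop
  refine ⟨m, hmQ, fun k hk => ?_, ?_⟩
  · have h1 : Tendsto (fun n => (inner ℝ k (F (z (θ (τ n)))) : ℝ)
        - ‖k‖ ^ 2 / (2 * ((θ (τ n) : ℝ) + 1))) atTop (𝓝 ((inner ℝ k (F w) : ℝ) - 0)) :=
      (tendsto_const_nhds.inner (hFw.comp hτ.tendsto_atTop)).sub ((hinv _).comp hτ.tendsto_atTop)
    rw [sub_zero] at h1
    have h2 : Tendsto (fun n => (inner ℝ (l (τ n)) (F (z (θ (τ n)))) : ℝ)) atTop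
        (𝓝 (inner ℝ m (F w))) := hm.inner (hFw.comp hτ.tendsto_atTop)
    refine le_of_tendsto_of_tendsto' h1 h2 fun n => ?_
    have h3 := le_moreauSupport (hpos (θ (τ n))) hk (F (z (θ (τ n))))
    rw [hleq] at h3
    have h4 : 0 ≤ ‖l (τ n)‖ ^ 2 / (2 * ((θ (τ n) : ℝ) + 1)) := by positivity
    linarith
  · have hcont : ContinuousAt (fderiv ℝ F) w :=
      (hF.fderiv_right (m := 0) (by simp)).continuousAt
    have h1 : Tendsto (fun n => ContinuousLinearMap.adjoint (fderiv ℝ F (z (θ (τ n)))))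
        atTop (𝓝 (ContinuousLinearMap.adjoint (fderiv ℝ F w))) :=
      ((ContinuousLinearMap.adjoint (𝕜 := ℝ) (E := E) (F := E')).continuous.tendsto _).comp
        (hcont.tendsto.comp hzτ)
    exact le_of_tendsto ((tendsto_clm_apply h1 hm).sub_const v).norm (hτ.tendsto_atTop.eventually hev)

/-- Multiplier rule for limiting subgradients of `a + σ_Q ∘ F`. -/
theorem exists_multiplier_of_mem_subdiff {φ : E → EReal} {Q : Set E'} {F : E → E'}
    (hne : Q.Nonempty) (hcl : IsClosed Q) (hQ : Convex ℝ Q) {x v : E} {a C : ℝ}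
    (hφ : ∀ᶠ y in 𝓝 x, φ y = a + supportFun Q (F y)) (hF : ContDiffAt ℝ 1 F x)
    (hC : ∀ᶠ y in 𝓝 x, ∀ k ∈ Q,
      ‖k‖ ≤ C * (1 + ‖ContinuousLinearMap.adjoint (fderiv ℝ F y) k‖)) (hC0 : 0 ≤ C)
    (hv : v ∈ subdiff φ x) :
    ∃ l ∈ Q, (∀ k ∈ Q, (inner ℝ k (F x) : ℝ) ≤ inner ℝ l (F x)) ∧
      ContinuousLinearMap.adjoint (fderiv ℝ F x) l = v := by
  obtain ⟨-, y, w, hy, -, hw, hwv⟩ := hv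
  -- The `2` in the bound is `1` from `‖w n‖ < ‖v‖ + 1` plus `1` from the tolerance `1 / (n + 1)`.
  have hev : ∀ᶠ n in atTop, ∃ l ∈ Q, (∀ k ∈ Q, (inner ℝ k (F (y n)) : ℝ) ≤ inner ℝ l (F (y n))) ∧
      ‖ContinuousLinearMap.adjoint (fderiv ℝ F (y n)) l - w n‖ ≤ 1 / ((n : ℝ) + 1) ∧
      ‖l‖ ≤ C * (1 + (‖v‖ + 2)) := by
    have hwn : ∀ᶠ n in atTop, ‖w n‖ < ‖v‖ + 1 :=
      hwv.norm.eventually_lt_const (by linarith)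
    filter_upwards [hy.eventually hφ.eventually_nhds, hy.eventually (hF.eventually (by simp)),
      hy.eventually hC.eventually_nhds, hwn] with n h1 h2 h3 h4
    obtain ⟨l, hl, hmax, hnorm⟩ := exists_approx_multiplier_of_mem_regularSubdiff hne hcl hQ h1 h2
      h3 hC0 (hw n) (ε := 1 / ((n : ℝ) + 1)) (by positivity)
    refine ⟨l, hl, hmax, hnorm, (h3.self_of_nhds l hl).trans ?_⟩
    have h5 := norm_le_norm_add_norm_sub' (ContinuousLinearMap.adjoint (fderiv ℝ F (y n)) l) (w n)
    have h6 : 1 / ((n : ℝ) + 1) ≤ 1 := by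
      rw [div_le_one (by positivity)]
      linarith [n.cast_nonneg (α := ℝ)]
    gcongr
    linarith
  obtain ⟨N, hN⟩ := eventually_atTop.1 hev
  choose l hlQ hmax hnorm hbdd using fun n : ℕ => hN (n + N) (Nat.le_add_left _ _)
  obtain ⟨m, -, τ, hτ, hm⟩ := (isCompact_closedBall (0 : E') (C * (1 + (‖v‖ + 2)))).tendsto_subseq
    (fun n => mem_closedBall_zero_iff.2 (hbdd n))
  have hτN : Tendsto (fun n => τ n + N) atTop atTop :=
    (tendsto_add_atTop_nat N).comp hτ.tendsto_atTop
  have hyτ : Tendsto (fun n => y (τ n + N)) atTop (𝓝 x) := hy.comp hτN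
  have hFy := hF.continuousAt.tendsto.comp hyτ
  refine ⟨m, hcl.mem_of_tendsto hm (Eventually.of_forall fun n => hlQ _), fun k hk => ?_, ?_⟩
  · exact le_of_tendsto_of_tendsto' (tendsto_const_nhds.inner hFy) (hm.inner hFy)
      fun n => hmax _ k hk
  · have hcont : ContinuousAt (fderiv ℝ F) x :=
      (hF.fderiv_right (m := 0) (by simp)).continuousAt
    have h1 : Tendsto (fun n => ContinuousLinearMap.adjoint (fderiv ℝ F (y (τ n + N))))
        atTop (𝓝 (ContinuousLinearMap.adjoint (fderiv ℝ F x))) :=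
      ((ContinuousLinearMap.adjoint (𝕜 := ℝ) (E := E) (F := E')).continuous.tendsto _).comp
        (hcont.tendsto.comp hyτ)
    have h2 := ((tendsto_clm_apply h1 hm).sub (hwv.comp hτN)).norm
    have h3 : ‖ContinuousLinearMap.adjoint (fderiv ℝ F x) m - v‖ ≤ 0 :=
      le_of_tendsto_of_tendsto' h2
        ((tendsto_one_div_add_atTop_nhds_zero_nat (𝕜 := ℝ)).comp hτN) fun n => hnorm _
    exact sub_eq_zero.1 (norm_le_zero_iff.1 h3)

end MultiplierRule

/-! ### First- and second-order expansions with moving base point. -/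

section Calculus

variable {E : Type*} [NormedAddCommGroup E] [NormedSpace ℝ E]
variable {G : Type*} [NormedAddCommGroup G] [NormedSpace ℝ G]

theorem tendsto_inv_smul_of_hasStrictFDerivAt {F : E → G} {A : E →L[ℝ] G} {x₀ h₀ : E}
    (hF : HasStrictFDerivAt F A x₀) {α : Type*} {u : Filter α} {t : α → ℝ} {h x : α → E}
    (ht : Tendsto t u (𝓝[≠] 0)) (hh : Tendsto h u (𝓝 h₀)) (hx : Tendsto x u (𝓝 x₀)) :
    Tendsto (fun a => (t a)⁻¹ • (F (x a + t a • h a) - F (x a))) u (𝓝 (A h₀)) := by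
  have ht0 := tendsto_nhdsWithin_iff.1 ht
  have hxt : Tendsto (fun a => x a + t a • h a) u (𝓝 x₀) := by
    simpa using hx.add (ht0.1.smul hh)
  have h1 := hF.isLittleO.comp_tendsto (hxt.prodMk_nhds hx)
  have h2 : (fun a => (x a + t a • h a) - x a) =O[u] t := by
    have := (Asymptotics.isBigO_refl t u).smul (hh.isBigO_one ℝ)
    simpa using this
  have h3 := (h1.trans_isBigO h2).tendsto_inv_smul_nhds_zero
  have h4 := h3.add ((A.continuous.tendsto h₀).comp hh)
  rw [zero_add] at h4
  refine h4.congr' ?_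
  filter_upwards [ht0.2] with a ha
  have ha : t a ≠ 0 := ha
  simp [smul_sub, ha, smul_smul]

/-- Second-order Taylor expansion that is uniform in the base point. -/
theorem isLittleO_taylor_two {F : E → G} {B : E →L[ℝ] E →L[ℝ] G} {x₀ : E}
    (hF : ∀ᶠ y in 𝓝 x₀, DifferentiableAt ℝ F y) (hB : HasStrictFDerivAt (fderiv ℝ F) B x₀) :
    (fun p : E × E => F (p.1 + p.2) - F p.1 - fderiv ℝ F p.1 p.2 - (1 / 2 : ℝ) • B p.2 p.2)
      =o[𝓝 (x₀, 0)] fun p => ‖p.2‖ ^ 2 := by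
  refine Asymptotics.IsLittleO.of_bound fun c hc => ?_
  obtain ⟨δ, hδ, hball⟩ := Metric.nhds_basis_ball.eventually_iff.1
    ((hF.prod_inl_nhds x₀).and (hB.isLittleO.def hc))
  have hmem : Metric.ball (x₀, (0 : E)) (δ / 2) ∈ 𝓝 (x₀, (0 : E)) :=
    Metric.ball_mem_nhds _ (half_pos hδ)
  filter_upwards [hmem] with ⟨x, k⟩ hxk
  rw [Metric.mem_ball, Prod.dist_eq, max_lt_iff, dist_zero_right] at hxk
  obtain ⟨hx, hk⟩ := hxk
  dsimp only at hx hk ⊢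
  have hseg : ∀ s ∈ Icc (0 : ℝ) 1, (x + s • k, x) ∈ Metric.ball (x₀, x₀) δ := by
    intro s hs
    rw [Metric.mem_ball, Prod.dist_eq, max_lt_iff]
    dsimp only
    refine ⟨?_, by linarith⟩
    have h1 : dist (x + s • k) x₀ ≤ ‖s • k‖ + dist x x₀ := by
      rw [dist_eq_norm, dist_eq_norm, add_sub_right_comm, add_comm]
      exact norm_add_le _ _
    have h2 : ‖s • k‖ ≤ ‖k‖ := by
      rw [norm_smul, Real.norm_of_nonneg hs.1]
      exact mul_le_of_le_one_left (norm_nonneg _) hs.2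
    linarith
  -- The mean value inequality is applied to the Taylor remainder along the segment; strict
  -- differentiability of `fderiv ℝ F` bounds its derivative by `c * ‖k‖ ^ 2`.
  have hder : ∀ s ∈ Icc (0 : ℝ) 1, HasDerivWithinAt
      (fun s : ℝ => F (x + s • k) - s • fderiv ℝ F x k - (s ^ 2 / 2) • B k k)
      (fderiv ℝ F (x + s • k) k - fderiv ℝ F x k - s • B k k) (Icc 0 1) s := by
    intro s hs
    have h1 : HasDerivAt (fun s : ℝ => x + s • k) k s := by
      simpa using ((hasDerivAt_id s).smul_const k).const_add x
    have h2 := ((hball (hseg s hs)).1.hasFDerivAt.comp_hasDerivAt s h1)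
    have h3 : HasDerivAt (fun s : ℝ => s • fderiv ℝ F x k) (fderiv ℝ F x k) s := by
      simpa using (hasDerivAt_id s).smul_const (fderiv ℝ F x k)
    have h4 : HasDerivAt (fun s : ℝ => (s ^ 2 / 2) • B k k) (s • B k k) s := by
      have := (((hasDerivAt_id s).pow 2).div_const 2).smul_const (B k k)
      simpa using this
    exact ((h2.sub h3).sub h4).hasDerivWithinAt
  have hbound : ∀ s ∈ Ico (0 : ℝ) 1,
      ‖fderiv ℝ F (x + s • k) k - fderiv ℝ F x k - s • B k k‖ ≤ c * ‖k‖ ^ 2 := by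
    intro s hs
    have h1 := (hball (hseg s (Ico_subset_Icc_self hs))).2
    dsimp only at h1
    rw [add_sub_cancel_left] at h1
    have h2 := (ContinuousLinearMap.le_opNorm (fderiv ℝ F (x + s • k) - fderiv ℝ F x - B (s • k)) k)
    have h3 : ‖s • k‖ ≤ ‖k‖ := by
      rw [norm_smul, Real.norm_of_nonneg hs.1]
      exact mul_le_of_le_one_left (norm_nonneg _) hs.2.le
    calc _ = ‖(fderiv ℝ F (x + s • k) - fderiv ℝ F x - B (s • k)) k‖ := by simp
      _ ≤ _ := h2
      _ ≤ (c * ‖k‖) * ‖k‖ := by gcongr; exact h1.trans (by gcongr)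
      _ = _ := by ring
  have := norm_image_sub_le_of_norm_deriv_le_segment_01' hder hbound
  rw [norm_pow, norm_norm]
  refine le_trans (le_of_eq ?_) this
  congr 1
  simp
  abel

theorem tendsto_taylor_two {F : E → G} {B : E →L[ℝ] E →L[ℝ] G} {x₀ h₀ : E}
    (hF : ∀ᶠ y in 𝓝 x₀, DifferentiableAt ℝ F y) (hB : HasStrictFDerivAt (fderiv ℝ F) B x₀)
    {α : Type*} {u : Filter α} {t : α → ℝ} {h x : α → E}
    (ht : Tendsto t u (𝓝[≠] 0)) (hh : Tendsto h u (𝓝 h₀)) (hx : Tendsto x u (𝓝 x₀)) :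
    Tendsto (fun a => (t a ^ 2 / 2)⁻¹ • (F (x a + t a • h a) - F (x a)
      - t a • fderiv ℝ F (x a) (h a))) u (𝓝 (B h₀ h₀)) := by
  have ht0 := tendsto_nhdsWithin_iff.1 ht
  have hth : Tendsto (fun a => t a • h a) u (𝓝 0) := by simpa using ht0.1.smul hh
  have h1 := (isLittleO_taylor_two hF hB).comp_tendsto (hx.prodMk_nhds hth)
  have h2 : (fun a => ‖t a • h a‖ ^ 2) =O[u] fun a => t a ^ 2 / 2 := by
    have h3 := ((Asymptotics.isBigO_refl t u).smul (hh.isBigO_one ℝ)).norm_left.pow 2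
    refine h3.trans (Asymptotics.IsBigO.of_bound 2 (Eventually.of_forall fun a => ?_))
    simp
    linarith
  have h3 := (h1.trans_isBigO h2).tendsto_inv_smul_nhds_zero
  have h4 := h3.add (tendsto_clm_apply ((B.continuous.tendsto h₀).comp hh) hh)
  rw [zero_add] at h4
  refine h4.congr' ?_
  filter_upwards [ht0.2] with a ha
  have ha : t a ≠ 0 := ha
  have e : (t a ^ 2 / 2)⁻¹ • (1 / 2 : ℝ) • B (t a • h a) (t a • h a) = B (h a) (h a) := by
    rw [map_smul, map_smul, smul_apply, smul_smul, smul_smul, smul_smul]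
    rw [show (t a ^ 2 / 2)⁻¹ * (1 / 2) * t a * t a = 1 by field_simp, one_smul]
  simp only [Function.comp_apply]
  rw [smul_sub _ _ ((1 / 2 : ℝ) • _), e, map_smul, sub_add_cancel]

end Calculus

/-! ### Lower estimate for the strict second subderivative. -/

section SubderivativeInequality

variable {E : Type*} [NormedAddCommGroup E] [InnerProductSpace ℝ E]
variable {E' : Type*} [NormedAddCommGroup E'] [InnerProductSpace ℝ E']
variable {φ : E → EReal} {xbar : E} {Q : Set E'} {F : E → E'} {lbar : E'}

theorem IsDecomposable.contDiffAt {ℓ : ℕ} (hφ : IsDecomposable ℓ φ xbar Q F) :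
    ContDiffAt ℝ ℓ F xbar := by
  obtain ⟨U, hU, hxU, hF, -⟩ := hφ.decomp
  exact hF.contDiffAt (hU.mem_nhds hxU)

theorem IsDecomposable.exists_eventually_eq {ℓ : ℕ} (hφ : IsDecomposable ℓ φ xbar Q F) :
    ∃ a : ℝ, φ xbar = a ∧ ∀ᶠ y in 𝓝 xbar, φ y = a + supportFun Q (F y) := by
  obtain ⟨U, hU, hxU, -, h⟩ := hφ.decomp
  have ha : φ xbar = ((φ xbar).toReal : EReal) :=
    (EReal.coe_toReal (ne_of_lt hφ.mem_dom) (hφ.ne_bot _)).symm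
  refine ⟨(φ xbar).toReal, ha, ?_⟩
  filter_upwards [hU.mem_nhds hxU] with y hy
  rw [← ha, h y hy]

variable [FiniteDimensional ℝ E] [FiniteDimensional ℝ E']

/-- Maximality makes `σ_Q` at `F x` equal to the pairing with `l`; adding and subtracting the
pairing of `l` with the increment of `F` separates the two terms. If the new value is infinite, both
sides are `⊤`. -/
theorem secondDiffQuot_comp {φ : E → EReal} {Q : Set E'} {F : E → E'} {a t : ℝ} {x h : E}
    {l : E'} (ht : 0 < t) (hl : l ∈ Q) (hmax : ∀ k ∈ Q, (inner ℝ k (F x) : ℝ) ≤ inner ℝ l (F x))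
    (hx : φ x = a + supportFun Q (F x))
    (hxt : φ (x + t • h) = a + supportFun Q (F (x + t • h))) :
    secondDiffQuot φ t x (ContinuousLinearMap.adjoint (fderiv ℝ F x) l) h =
      secondDiffQuot (supportFun Q) t (F x) l (t⁻¹ • (F (x + t • h) - F x)) +
      ((inner ℝ l ((t ^ 2 / 2)⁻¹ • (F (x + t • h) - F x - t • fderiv ℝ F x h)) : ℝ) : EReal) := by
  have hpos : (0 : ℝ) < t ^ 2 / 2 := by positivity
  have e : F x + t • t⁻¹ • (F (x + t • h) - F x) = F (x + t • h) := by
    rw [smul_inv_smul₀ ht.ne', add_sub_cancel]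
  unfold secondDiffQuot
  rw [e, hx, hxt, supportFun_eq_of_forall_le hl hmax]
  rcases eq_or_ne (supportFun Q (F (x + t • h))) ⊤ with hs | hs
  · rw [hs, EReal.coe_add_top, ← EReal.coe_add, EReal.top_sub_coe, EReal.top_sub_coe,
      EReal.top_sub_coe, EReal.top_sub_coe,
      EReal.top_div_of_pos_ne_top (EReal.coe_pos.2 hpos) (EReal.coe_ne_top _), EReal.top_add_coe]
  · obtain ⟨s, hs⟩ : ∃ s : ℝ, supportFun Q (F (x + t • h)) = s :=
      ⟨_, (EReal.coe_toReal hs (supportFun_ne_bot ⟨l, hl⟩ _)).symm⟩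
    rw [hs]
    simp only [← EReal.coe_add, ← EReal.coe_sub, ← EReal.coe_div]
    rw [EReal.coe_eq_coe_iff, ContinuousLinearMap.adjoint_inner_left]
    simp only [real_inner_smul_right, inner_sub_right]
    field_simp
    ring

/-- Perturbing the derivative costs a multiple of `‖k‖`, which is absorbed on the left once that
multiple times `C` is below `1 / 2`; hence the factor `2`. -/
theorem eventually_norm_sub_le {F : E → E'} {Q : Set E'} {x : E} {l : E'} {C : ℝ} (hC : 0 ≤ C)
    (hQ : ∀ k ∈ Q, ‖k - l‖ ≤ C * ‖ContinuousLinearMap.adjoint (fderiv ℝ F x) (k - l)‖)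
    (hF : ContinuousAt (fderiv ℝ F) x) :
    ∀ᶠ y in 𝓝 x, ∀ k ∈ Q, ‖k - l‖ ≤
      2 * C * (‖ContinuousLinearMap.adjoint (fderiv ℝ F y) k
        - ContinuousLinearMap.adjoint (fderiv ℝ F x) l‖ + ‖fderiv ℝ F y - fderiv ℝ F x‖ * ‖l‖) := by
  have h1 : Tendsto (fun y => C * ‖fderiv ℝ F y - fderiv ℝ F x‖) (𝓝 x) (𝓝 0) := by
    have h : Tendsto (fderiv ℝ F) (𝓝 x) (𝓝 (fderiv ℝ F x)) := hF
    simpa using (h.sub_const (fderiv ℝ F x)).norm.const_mul C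
  filter_upwards [h1.eventually_lt_const (u := 1 / 2) (by norm_num)] with y hy k hk
  set d := ‖ContinuousLinearMap.adjoint (fderiv ℝ F y) k
        - ContinuousLinearMap.adjoint (fderiv ℝ F x) l‖
  set η := ‖fderiv ℝ F y - fderiv ℝ F x‖
  have h2 : ‖ContinuousLinearMap.adjoint (fderiv ℝ F x) (k - l)‖ ≤ d + η * ‖k‖ := by
    have e : ContinuousLinearMap.adjoint (fderiv ℝ F x) (k - l) =
        (ContinuousLinearMap.adjoint (fderiv ℝ F y) k
          - ContinuousLinearMap.adjoint (fderiv ℝ F x) l)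
        - ContinuousLinearMap.adjoint (fderiv ℝ F y - fderiv ℝ F x) k := by
      rw [map_sub, map_sub, sub_apply]
      abel
    rw [e]
    refine (norm_sub_le _ _).trans (add_le_add_right ?_ _)
    refine (ContinuousLinearMap.le_opNorm _ _).trans (le_of_eq ?_)
    rw [LinearIsometryEquiv.norm_map]
  have h3 : ‖k‖ ≤ ‖k - l‖ + ‖l‖ := by simpa using norm_add_le (k - l) l
  have h4 := hQ k hk
  have h5 : C * ‖ContinuousLinearMap.adjoint (fderiv ℝ F x) (k - l)‖ ≤ C * (d + η * ‖k‖) := by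
    gcongr
  have h6 : (C * η) * ‖k‖ ≤ (C * η) * (‖k - l‖ + ‖l‖) := by gcongr
  have h7 : (C * η) * ‖k - l‖ ≤ 1 / 2 * ‖k - l‖ := by gcongr
  nlinarith

/-- Near the reference point of its graph, every subgradient of a strictly decomposable function
has a multiplier, which is close to the reference multiplier. -/
theorem IsStrictlyDecomposable.exists_multiplier
    (hφ : IsStrictlyDecomposable 2 φ xbar Q F lbar) :
    ∃ Λ : E × E → E',
      (∀ᶠ q in 𝓝[gphSubdiff φ] (xbar, ContinuousLinearMap.adjoint (fderiv ℝ F xbar) lbar),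
        Λ q ∈ Q ∧ (∀ k ∈ Q, (inner ℝ k (F q.1) : ℝ) ≤ inner ℝ (Λ q) (F q.1)) ∧
          ContinuousLinearMap.adjoint (fderiv ℝ F q.1) (Λ q) = q.2) ∧
      Tendsto Λ (𝓝[gphSubdiff φ] (xbar, ContinuousLinearMap.adjoint (fderiv ℝ F xbar) lbar))
        (𝓝 lbar) := by
  classical
  obtain ⟨a, -, ha⟩ := hφ.exists_eventually_eq
  have hF2 : ContDiffAt ℝ 2 F xbar := hφ.contDiffAt
  have hF1 : ContDiffAt ℝ 1 F xbar := hF2.of_le (by norm_num)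
  have hcont : ContinuousAt (fderiv ℝ F) xbar := (hF1.fderiv_right (m := 0) (by simp)).continuousAt
  obtain ⟨C, hC0, hC⟩ :=
    exists_norm_sub_le_of_range_sub_normalCone hφ.convex hφ.mem hφ.strict
  have hest := eventually_norm_sub_le hC0 hC hcont
  set A := fderiv ℝ F xbar with hA
  have hη : Tendsto (fun y => ‖fderiv ℝ F y - A‖) (𝓝 xbar) (𝓝 0) := by
    have h : Tendsto (fderiv ℝ F) (𝓝 xbar) (𝓝 A) := hcont
    simpa using (h.sub_const A).norm
  set R := ‖lbar‖ + 2 * C * (1 + ‖ContinuousLinearMap.adjoint A lbar‖ + ‖lbar‖) with hR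
  have hbd : ∀ᶠ y in 𝓝 xbar, ∀ k ∈ Q,
      ‖k‖ ≤ R * (1 + ‖ContinuousLinearMap.adjoint (fderiv ℝ F y) k‖) := by
    filter_upwards [hest, hη.eventually_lt_const zero_lt_one] with y hy hy1 k hk
    have h1 := hy k hk
    have h2 := norm_sub_le (ContinuousLinearMap.adjoint (fderiv ℝ F y) k)
      (ContinuousLinearMap.adjoint A lbar)
    have h3 : ‖k‖ ≤ ‖k - lbar‖ + ‖lbar‖ := by simpa using norm_add_le (k - lbar) lbar
    set d := ‖ContinuousLinearMap.adjoint (fderiv ℝ F y) k‖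
    have h4 : 2 * C * (‖ContinuousLinearMap.adjoint (fderiv ℝ F y) k
        - ContinuousLinearMap.adjoint A lbar‖ + ‖fderiv ℝ F y - A‖ * ‖lbar‖) ≤
        2 * C * ((d + ‖ContinuousLinearMap.adjoint A lbar‖) + 1 * ‖lbar‖) := by gcongr
    have hd : 0 ≤ d := norm_nonneg _
    have h5 : 0 ≤ ‖lbar‖ * d + 2 * C * (1 + d * (‖ContinuousLinearMap.adjoint A lbar‖ + ‖lbar‖)) := by
      positivity
    rw [hR]
    linarith
  have hmult : ∀ᶠ y in 𝓝 xbar, ∀ v ∈ subdiff φ y, ∃ l ∈ Q,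
      (∀ k ∈ Q, (inner ℝ k (F y) : ℝ) ≤ inner ℝ l (F y)) ∧
        ContinuousLinearMap.adjoint (fderiv ℝ F y) l = v := by
    filter_upwards [ha.eventually_nhds, hF1.eventually (by simp), hbd.eventually_nhds]
      with y h1 h2 h3 v hv
    exact exists_multiplier_of_mem_subdiff hφ.nonempty hφ.closed hφ.convex h1 h2 h3
      (by positivity) hv
  have hfst : Tendsto Prod.fst
      (𝓝[gphSubdiff φ] (xbar, ContinuousLinearMap.adjoint A lbar)) (𝓝 xbar) :=
    (continuous_fst.tendsto _).mono_left nhdsWithin_le_nhds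
  have hsnd : Tendsto Prod.snd (𝓝[gphSubdiff φ] (xbar, ContinuousLinearMap.adjoint A lbar))
      (𝓝 (ContinuousLinearMap.adjoint A lbar)) :=
    (continuous_snd.tendsto _).mono_left nhdsWithin_le_nhds
  -- Any selection of multipliers will do: the error bound alone forces convergence to `lbar`.
  let P : E × E → E' → Prop := fun q l => l ∈ Q ∧
    (∀ k ∈ Q, (inner ℝ k (F q.1) : ℝ) ≤ inner ℝ l (F q.1)) ∧
      ContinuousLinearMap.adjoint (fderiv ℝ F q.1) l = q.2
  have hP : ∀ᶠ q in 𝓝[gphSubdiff φ] (xbar, ContinuousLinearMap.adjoint A lbar),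
      P q (Classical.epsilon (P q)) := by
    filter_upwards [hfst.eventually hmult, self_mem_nhdsWithin] with q hq hqg
    exact Classical.epsilon_spec (hq q.2 hqg)
  refine ⟨fun q => Classical.epsilon (P q), hP, ?_⟩
  rw [tendsto_iff_norm_sub_tendsto_zero]
  have hlim : Tendsto (fun q : E × E => 2 * C * (‖q.2 - ContinuousLinearMap.adjoint A lbar‖
      + ‖fderiv ℝ F q.1 - A‖ * ‖lbar‖))
      (𝓝[gphSubdiff φ] (xbar, ContinuousLinearMap.adjoint A lbar)) (𝓝 0) := by
    have h1 := (hsnd.sub_const (ContinuousLinearMap.adjoint A lbar)).norm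
    have h2 := (hη.comp hfst).mul_const ‖lbar‖
    simpa using (h1.add h2).const_mul (2 * C)
  refine squeeze_zero' (Eventually.of_forall fun _ => norm_nonneg _) ?_ hlim
  filter_upwards [hP, hfst.eventually hest] with q hq hqe
  have := hqe _ hq.1
  rwa [hq.2.2] at this

theorem IsStrictlyDecomposable.le_strictSecondSubderiv
    (hφ : IsStrictlyDecomposable 2 φ xbar Q F lbar) (h : E) :
    strictSecondSubderiv (supportFun Q) 0 lbar (fderiv ℝ F xbar h)
        + ((inner ℝ lbar (fderiv ℝ (fderiv ℝ F) xbar h h) : ℝ) : EReal) ≤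
      strictSecondSubderiv φ xbar (ContinuousLinearMap.adjoint (fderiv ℝ F xbar) lbar) h := by
  obtain ⟨a, -, ha⟩ := hφ.exists_eventually_eq
  have hF2 : ContDiffAt ℝ 2 F xbar := hφ.contDiffAt
  have hdiff : ∀ᶠ y in 𝓝 xbar, DifferentiableAt ℝ F y :=
    (hF2.eventually (by simp)).mono fun y hy => hy.differentiableAt (by simp)
  have hstrict : HasStrictFDerivAt F (fderiv ℝ F xbar) xbar := hF2.hasStrictFDerivAt (by simp)
  have hB : HasStrictFDerivAt (fderiv ℝ F) (fderiv ℝ (fderiv ℝ F) xbar) xbar :=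
    (hF2.fderiv_right (m := 1) (by norm_num)).hasStrictFDerivAt (by simp)
  obtain ⟨Λ, hΛ, hΛl⟩ := hφ.exists_multiplier
  set A := fderiv ℝ F xbar
  set B := fderiv ℝ (fderiv ℝ F) xbar
  set W := 𝓝[gphSubdiff φ] (xbar, ContinuousLinearMap.adjoint A lbar) ⊓
    comap (fun q : E × E => φ q.1) (𝓝 (φ xbar)) with hW
  set L := 𝓝[>] (0 : ℝ) ×ˢ (𝓝 h ×ˢ W) with hL
  have hWle : W ≤ 𝓝[gphSubdiff φ] (xbar, ContinuousLinearMap.adjoint A lbar) := inf_le_left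
  have hq : Tendsto (fun p : ℝ × E × (E × E) => p.2.2) L W := tendsto_snd.comp tendsto_snd
  have hq' := hq.mono_right hWle
  have hx : Tendsto (fun p : ℝ × E × (E × E) => p.2.2.1) L (𝓝 xbar) :=
    (((continuous_fst.tendsto _).mono_left nhdsWithin_le_nhds).comp hq')
  have hh : Tendsto (fun p : ℝ × E × (E × E) => p.2.1) L (𝓝 h) := tendsto_fst.comp tendsto_snd
  have htpos : Tendsto (fun p : ℝ × E × (E × E) => p.1) L (𝓝[>] 0) := tendsto_fst
  have ht : Tendsto (fun p : ℝ × E × (E × E) => p.1) L (𝓝[≠] 0) :=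
    htpos.mono_right (nhdsWithin_mono _ fun t ht => ne_of_gt ht)
  have hxt : Tendsto (fun p : ℝ × E × (E × E) => p.2.2.1 + p.1 • p.2.1) L (𝓝 xbar) := by
    simpa using hx.add ((ht.mono_right nhdsWithin_le_nhds).smul hh)
  have hl : Tendsto (fun p : ℝ × E × (E × E) => Λ p.2.2) L (𝓝 lbar) := hΛl.comp hq'
  have hFx : Tendsto (fun p : ℝ × E × (E × E) => F p.2.2.1) L (𝓝 0) := by
    have := hF2.continuousAt.tendsto.comp hx
    rwa [hφ.map_zero] at this
  -- Transports the data of a quotient of `φ` to data admissible in the lower limit that defines the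
  -- subderivative of `σ_Q`.
  let T : ℝ × E × (E × E) → ℝ × E' × (E' × E') := fun p =>
    (p.1, p.1⁻¹ • (F (p.2.2.1 + p.1 • p.2.1) - F p.2.2.1), (F p.2.2.1, Λ p.2.2))
  have hT : Tendsto T L (𝓝[>] (0 : ℝ) ×ˢ (𝓝 (A h) ×ˢ
      (𝓝[gphSubdiff (supportFun Q)] ((0 : E'), lbar) ⊓
        comap (fun q : E' × E' => supportFun Q q.1) (𝓝 (supportFun Q 0))))) := by
    refine htpos.prodMk ((tendsto_inv_smul_of_hasStrictFDerivAt hstrict ht hh hx).prodMk ?_)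
    refine tendsto_inf.2 ⟨tendsto_nhdsWithin_iff.2 ⟨hFx.prodMk_nhds hl, ?_⟩, ?_⟩
    · filter_upwards [hq'.eventually hΛ] with p hp
      exact mem_subdiff_supportFun hp.1 hp.2.1
    · rw [tendsto_comap_iff, supportFun_zero hφ.nonempty]
      have h1 : Tendsto (fun p : ℝ × E × (E × E) => ((inner ℝ (Λ p.2.2) (F p.2.2.1) : ℝ) : EReal))
          L (𝓝 0) := by
        have := (continuous_coe_real_ereal.tendsto _).comp (hl.inner hFx)
        simpa [Function.comp_def] using this
      refine h1.congr' ?_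
      filter_upwards [hq'.eventually hΛ] with p hp
      exact (supportFun_eq_of_forall_le hp.1 hp.2.1).symm
  let r : ℝ × E × (E × E) → EReal := fun p => ((inner ℝ (Λ p.2.2) ((p.1 ^ 2 / 2)⁻¹ •
    (F (p.2.2.1 + p.1 • p.2.1) - F p.2.2.1 - p.1 • fderiv ℝ F p.2.2.1 p.2.1)) : ℝ) : EReal)
  have hr : Tendsto r L (𝓝 ((inner ℝ lbar (B h h) : ℝ) : EReal)) :=
    (continuous_coe_real_ereal.tendsto _).comp
      (hl.inner (tendsto_taylor_two hdiff hB ht hh hx))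
  have heq : (fun p : ℝ × E × (E × E) => secondDiffQuot φ p.1 p.2.2.1 p.2.2.2 p.2.1) =ᶠ[L]
      (fun p => secondDiffQuot (supportFun Q) (T p).1 (T p).2.2.1 (T p).2.2.2 (T p).2.1) + r := by
    filter_upwards [hq'.eventually hΛ, hx.eventually ha, hxt.eventually ha,
      htpos.eventually self_mem_nhdsWithin] with p hp h1 h2 h3
    have := secondDiffQuot_comp h3 hp.1 hp.2.1 h1 h2
    rwa [hp.2.2] at this
  change _ ≤ liminf (fun p : ℝ × E × (E × E) => secondDiffQuot φ p.1 p.2.2.1 p.2.2.2 p.2.1) L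
  rcases L.eq_or_neBot with hbot | hne
  · rw [hbot, liminf_bot]
    exact le_top
  rw [liminf_congr heq, ← hr.liminf_eq]
  refine le_trans (add_le_add_left ?_ _) EReal.le_liminf_add
  exact liminf_le_liminf_of_le hT

end SubderivativeInequality

/-! ### Curves mapped into the normal cone. -/

section Curves

variable {E : Type*} [NormedAddCommGroup E] [InnerProductSpace ℝ E]
variable {E' : Type*} [NormedAddCommGroup E'] [InnerProductSpace ℝ E'] [FiniteDimensional ℝ E']

/-- A convex set containing the origin has a relative interior point. -/
theorem exists_ball_inter_span_subset {N : Set E'} (hN : Convex ℝ N) (h0 : (0 : E') ∈ N) :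
    ∃ b ∈ N, ∃ ε : ℝ, 0 < ε ∧ ∀ s ∈ Submodule.span ℝ N, ‖s‖ < ε → b + s ∈ N := by
  obtain ⟨b, hb⟩ := Set.Nonempty.intrinsicInterior hN ⟨0, h0⟩
  obtain ⟨y, hy, rfl⟩ := mem_intrinsicInterior.1 hb
  obtain ⟨ε, hε, hball⟩ := Metric.mem_nhds_iff.1 (mem_interior_iff_mem_nhds.1 hy)
  refine ⟨y, hball (Metric.mem_ball_self hε), ε, hε, fun s hs hsε => ?_⟩
  have hmem : (y : E') + s ∈ affineSpan ℝ N := by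
    have hdir : s ∈ (affineSpan ℝ N).direction := by
      rw [direction_affineSpan, vectorSpan_eq_span_vsub_set_right ℝ h0]
      simpa using hs
    have := AffineSubspace.vadd_mem_of_mem_direction hdir y.2
    rwa [vadd_eq_add, add_comm] at this
  have : (⟨(y : E') + s, hmem⟩ : affineSpan ℝ N) ∈ Metric.ball y ε := by
    rw [Metric.mem_ball, Subtype.dist_eq, dist_eq_norm]
    simpa using hsε
  exact hball this

variable [FiniteDimensional ℝ E]

/-- Directions that the derivative maps to the relative interior of a polar cone are tangent to
curves along which the mapping stays in the cone. -/
theorem exists_curve_mem_polar {F : E → E'} {A : E →L[ℝ] E'} {xbar u : E} {C : Set E'}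
    (hF : HasStrictFDerivAt F A xbar) (hF0 : F xbar = 0) (hA : range A - polar C = univ)
    {ε : ℝ} (hε : 0 < ε)
    (hu : ∀ s ∈ Submodule.span ℝ (polar C), ‖s‖ < ε → A u + s ∈ polar C) :
    ∃ x : ℝ → E, x 0 = xbar ∧ HasDerivAt x u 0 ∧ ∀ᶠ t in 𝓝[>] (0 : ℝ), F (x t) ∈ polar C := by
  set S := Submodule.span ℝ (polar C) with hS
  have hAu : A u ∈ S := Submodule.subset_span (by simpa using hu 0 S.zero_mem (by simpa using hε))
  -- Projecting away the span of the cone leaves the equation `P (F x) = 0`. Its derivative is onto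
  -- because `P` kills the cone part of every decomposition in `hA`.
  let P : E' →L[ℝ] Sᗮ := Sᗮ.orthogonalProjectionOnto
  have hP : ∀ w, P w = 0 ↔ w ∈ S := fun w => by
    rw [Submodule.orthogonalProjectionOnto_eq_zero_iff, Submodule.orthogonal_orthogonal]
  have hf : HasStrictFDerivAt (P ∘ F) (P.comp A) xbar :=
    P.hasStrictFDerivAt.comp xbar hF
  have hrange : (P.comp A : E →L[ℝ] Sᗮ).range = ⊤ := by
    rw [LinearMap.range_eq_top]
    intro w
    obtain ⟨_, ⟨z, rfl⟩, ν, hν, hw⟩ := mem_sub.1 (hA.symm ▸ mem_univ (w : E'))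
    refine ⟨z, ?_⟩
    have h1 : P ν = 0 := (hP ν).2 (Submodule.subset_span hν)
    have h2 : P (w : E') = w := Submodule.orthogonalProjectionOnto_mem_subspace_eq_self w
    have h3 : P (A z) - P ν = w := by rw [← map_sub, hw, h2]
    rw [h1, sub_zero] at h3
    exact h3
  have hker : u ∈ (P.comp A : E →L[ℝ] Sᗮ).ker := (hP (A u)).2 hAu
  let g := HasStrictFDerivAt.implicitFunction (P ∘ F) (P.comp A) hf hrange ((P ∘ F) xbar)
  have hg0 : g 0 = xbar := hf.implicitFunction_apply_image hrange
  let c : ℝ → (P.comp A : E →L[ℝ] Sᗮ).ker := fun t => t • ⟨u, hker⟩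
  have hc0 : c 0 = 0 := zero_smul _ _
  have hc : HasDerivAt c ⟨u, hker⟩ 0 := by
    have h1 := (hasDerivAt_id (0 : ℝ)).smul_const (⟨u, hker⟩ : (P.comp A : E →L[ℝ] Sᗮ).ker)
    rwa [one_smul] at h1
  have hx : HasDerivAt (fun t => g (c t)) u 0 := by
    have h1 : HasFDerivAt g (P.comp A : E →L[ℝ] Sᗮ).ker.subtypeL (c 0) := by
      rw [hc0]
      exact (hf.to_implicitFunction hrange).hasFDerivAt
    exact h1.comp_hasDerivAt 0 hc
  have hx0 : g (c 0) = xbar := by rw [hc0, hg0]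
  refine ⟨fun t => g (c t), hx0, hx, ?_⟩
  have hFx : HasDerivAt (fun t => F (g (c t))) (A u) 0 := by
    have h1 : HasFDerivAt F A (g (c 0)) := by rw [hx0]; exact hF.hasFDerivAt
    exact h1.comp_hasDerivAt 0 hx
  have hslope := (hasDerivAt_iff_tendsto_slope_zero.1 hFx).mono_left
    (nhdsWithin_mono (0 : ℝ) fun t (ht : t ∈ Ioi 0) => ne_of_gt ht)
  have hct : Tendsto (fun t => ((P ∘ F) xbar, c t)) (𝓝[>] 0) (𝓝 ((P ∘ F) xbar, 0)) := by
    refine (tendsto_const_nhds.prodMk_nhds ?_)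
    rw [← hc0]
    exact hc.continuousAt.tendsto.mono_left nhdsWithin_le_nhds
  filter_upwards [hct.eventually (hf.map_implicitFunction_eq hrange),
    hslope.eventually (Metric.ball_mem_nhds _ hε), self_mem_nhdsWithin] with t h1 h2 ht
  have ht : 0 < t := ht
  have h3 : F (g (c t)) ∈ S := by
    have e : P (F (g (c t))) = P (F xbar) := h1
    rwa [hF0, map_zero, hP] at e
  rw [zero_add, hx0, hF0, sub_zero, dist_eq_norm] at h2
  -- `t⁻¹ • F` along the curve stays in `S` and tends to `A u`, so it enters the relative ball
  -- inside the cone; scaling by `t` gives the claim.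
  have h4 := hu _ (S.sub_mem (S.smul_mem t⁻¹ h3) hAu) h2
  rw [add_sub_cancel] at h4
  have h5 := smul_mem_polar ht.le h4
  rwa [smul_inv_smul₀ ht.ne'] at h5

/-- The direction `h` need not map into the cone, only into its span. It is realized as the
difference of the velocities `u + h` and `u`, with `A u` deep in the relative interior. -/
theorem exists_curves_mem_polar {F : E → E'} {A : E →L[ℝ] E'} {xbar h : E} {C : Set E'}
    (hF : HasStrictFDerivAt F A xbar) (hF0 : F xbar = 0) (hA : range A - polar C = univ)
    (hh : A h ∈ Submodule.span ℝ (polar C)) :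
    ∃ x y : ℝ → E, Tendsto x (𝓝[>] 0) (𝓝 xbar) ∧
      Tendsto (fun t => t⁻¹ • (y t - x t)) (𝓝[>] 0) (𝓝 h) ∧
      ∀ᶠ t in 𝓝[>] (0 : ℝ), F (x t) ∈ polar C ∧ F (y t) ∈ polar C := by
  obtain ⟨b, hb, ε, hε, hbε⟩ := exists_ball_inter_span_subset (convex_polar C) (zero_mem_polar C)
  -- Scaling `b` by `r` enlarges its relative ball to radius `‖A h‖ + 1`, which leaves radius `1`
  -- around `A (u + h)`.
  set r := (‖A h‖ + 1) / ε with hr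
  have hr0 : 0 < r := by positivity
  obtain ⟨_, ⟨u, rfl⟩, ν, hν, hu⟩ := mem_sub.1 (hA.symm ▸ mem_univ (r • b))
  have hball : ∀ s ∈ Submodule.span ℝ (polar C), ‖s‖ < ‖A h‖ + 1 → A u + s ∈ polar C := by
    intro s hs hsn
    have h1 : ‖r⁻¹ • s‖ < ε := by
      rw [norm_smul, norm_inv, Real.norm_of_nonneg hr0.le, inv_mul_lt_iff₀ hr0, hr,
        div_mul_cancel₀ _ hε.ne']
      exact hsn
    have h2 := smul_mem_polar hr0.le (hbε _ (Submodule.smul_mem _ r⁻¹ hs) h1)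
    rw [smul_add, smul_inv_smul₀ hr0.ne', ← hu] at h2
    have h3 := add_mem_polar h2 hν
    rwa [show A u - ν + s + ν = A u + s by abel] at h3
  obtain ⟨x, hx0, hx, hxN⟩ := exists_curve_mem_polar hF hF0 hA (u := u) (by positivity) hball
  obtain ⟨y, hy0, hy, hyN⟩ := exists_curve_mem_polar hF hF0 hA (u := u + h) one_pos (by
    intro s hs hs1
    rw [map_add, add_assoc]
    refine hball _ (Submodule.add_mem _ hh hs) ((norm_add_le _ _).trans_lt ?_)
    linarith)
  refine ⟨x, y, ?_, ?_, hxN.and hyN⟩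
  · have := hx.continuousAt.tendsto
    rw [hx0] at this
    exact this.mono_left nhdsWithin_le_nhds
  · have h1 := (hasDerivAt_iff_tendsto_slope_zero.1 (hy.sub hx)).mono_left
      (nhdsWithin_mono (0 : ℝ) fun t (ht : t ∈ Ioi 0) => ne_of_gt ht)
    simpa [hx0, hy0] using h1

end Curves

/-! ### Upper estimate along the curves. -/

section Equality

variable {E : Type*} [NormedAddCommGroup E] [InnerProductSpace ℝ E] [FiniteDimensional ℝ E]
variable {E' : Type*} [NormedAddCommGroup E'] [InnerProductSpace ℝ E'] [FiniteDimensional ℝ E']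

theorem adjoint_mem_regularSubdiff {φ : E → EReal} {Q : Set E'} {F : E → E'} {a : ℝ} {x : E}
    {l : E'} (hφ : ∀ᶠ y in 𝓝 x, φ y = a + supportFun Q (F y)) (hF : DifferentiableAt ℝ F x)
    (hl : l ∈ Q) (hmax : ∀ k ∈ Q, (inner ℝ k (F x) : ℝ) ≤ inner ℝ l (F x)) :
    ContinuousLinearMap.adjoint (fderiv ℝ F x) l ∈ regularSubdiff φ x := by
  have hx := hφ.self_of_nhds
  rw [supportFun_eq_of_forall_le hl hmax, ← EReal.coe_add] at hx
  refine ⟨?_, fun ε hε => ?_⟩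
  · change φ x < ⊤
    rw [hx]
    exact EReal.coe_lt_top _
  · have hd := ((hasFDerivAt_const l x).inner ℝ hF.hasFDerivAt).isLittleO.def hε
    filter_upwards [hφ, hd] with y hy h1
    rw [hx, hy, ← EReal.coe_add]
    refine le_trans ?_ (add_le_add_right (le_supportFun hl (F y)) _)
    rw [← EReal.coe_add, EReal.coe_le_coe_iff, ContinuousLinearMap.adjoint_inner_left]
    have h2 := neg_le_of_abs_le h1
    simp at h2 ⊢
    linarith

variable {φ : E → EReal} {xbar : E} {Q : Set E'} {F : E → E'} {lbar : E'}

theorem IsStrictlyDecomposable.strictSecondSubderiv_le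
    (hφ : IsStrictlyDecomposable 2 φ xbar Q F lbar) {h : E}
    (hh : fderiv ℝ F xbar h ∈ affineSpan ℝ (normalCone Q lbar)) :
    strictSecondSubderiv φ xbar (ContinuousLinearMap.adjoint (fderiv ℝ F xbar) lbar) h ≤
      ((inner ℝ lbar (fderiv ℝ (fderiv ℝ F) xbar h h) : ℝ) : EReal) := by
  obtain ⟨a, hax, ha⟩ := hφ.exists_eventually_eq
  have hF2 : ContDiffAt ℝ 2 F xbar := hφ.contDiffAt
  have hdiff : ∀ᶠ y in 𝓝 xbar, DifferentiableAt ℝ F y :=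
    (hF2.eventually (by simp)).mono fun y hy => hy.differentiableAt (by simp)
  have hstrict : HasStrictFDerivAt F (fderiv ℝ F xbar) xbar := hF2.hasStrictFDerivAt (by simp)
  have hB : HasStrictFDerivAt (fderiv ℝ F) (fderiv ℝ (fderiv ℝ F) xbar) xbar :=
    (hF2.fderiv_right (m := 1) (by norm_num)).hasStrictFDerivAt (by simp)
  obtain ⟨x, y, hx, hxy, hN⟩ := exists_curves_mem_polar (C := posTangentConeAt Q lbar) hstrict
    hφ.map_zero hφ.strict (affineSpan_subset_span hh)
  have htpos : Tendsto (fun t : ℝ => t) (𝓝[>] 0) (𝓝[>] 0) := tendsto_id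
  have ht : Tendsto (fun t : ℝ => t) (𝓝[>] 0) (𝓝[≠] 0) :=
    nhdsWithin_mono (0 : ℝ) fun t (ht : t ∈ Ioi 0) => ne_of_gt ht
  have hmax : ∀ z ∈ normalCone Q lbar, ∀ k ∈ Q, (inner ℝ k z : ℝ) ≤ inner ℝ lbar z :=
    fun z hz k hk => inner_le_of_mem_normalCone hφ.convex hφ.mem hz hk
  let p : ℝ → ℝ × E × (E × E) := fun t =>
    (t, t⁻¹ • (y t - x t), (x t, ContinuousLinearMap.adjoint (fderiv ℝ F (x t)) lbar))
  have hFx : Tendsto (fun t => F (x t)) (𝓝[>] 0) (𝓝 0) := by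
    have := hF2.continuousAt.tendsto.comp hx
    rwa [hφ.map_zero] at this
  have hadj : Tendsto (fun t => ContinuousLinearMap.adjoint (fderiv ℝ F (x t)) lbar) (𝓝[>] 0)
      (𝓝 (ContinuousLinearMap.adjoint (fderiv ℝ F xbar) lbar)) :=
    tendsto_clm_apply
      (((ContinuousLinearMap.adjoint (𝕜 := ℝ) (E := E) (F := E')).continuous.tendsto _).comp
        (hB.continuousAt.tendsto.comp hx)) tendsto_const_nhds
  have hp : Tendsto p (𝓝[>] 0) (𝓝[>] (0 : ℝ) ×ˢ (𝓝 h ×ˢ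
      (𝓝[gphSubdiff φ] (xbar, ContinuousLinearMap.adjoint (fderiv ℝ F xbar) lbar) ⊓
        comap (fun q : E × E => φ q.1) (𝓝 (φ xbar))))) := by
    refine htpos.prodMk (hxy.prodMk ?_)
    refine tendsto_inf.2 ⟨tendsto_nhdsWithin_iff.2 ⟨hx.prodMk_nhds hadj, ?_⟩, ?_⟩
    · filter_upwards [hx.eventually ha.eventually_nhds, hx.eventually hdiff, hN] with t h1 h2 h3
      exact regularSubdiff_subset_subdiff _ _
        (adjoint_mem_regularSubdiff h1 h2 hφ.mem (hmax _ h3.1))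
    · rw [tendsto_comap_iff, hax]
      have h1 : Tendsto (fun t => ((a + inner ℝ lbar (F (x t)) : ℝ) : EReal)) (𝓝[>] 0)
          (𝓝 (a : EReal)) := by
        have := (continuous_coe_real_ereal.tendsto _).comp
          ((tendsto_const_nhds (x := lbar)).inner hFx |>.const_add a)
        simpa [Function.comp_def] using this
      refine h1.congr' ?_
      filter_upwards [hx.eventually ha, hN] with t h2 h3
      change _ = φ (x t)
      rw [h2, supportFun_eq_of_forall_le hφ.mem (hmax _ h3.1), EReal.coe_add]
  have hy : ∀ t : ℝ, 0 < t → x t + t • t⁻¹ • (y t - x t) = y t := fun t ht => by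
    rw [smul_inv_smul₀ ht.ne', add_sub_cancel]
  have hxt : Tendsto (fun t : ℝ => x t + t • t⁻¹ • (y t - x t)) (𝓝[>] 0) (𝓝 xbar) := by
    simpa using hx.add ((ht.mono_right nhdsWithin_le_nhds).smul hxy)
  have hlim : Tendsto (fun t => secondDiffQuot φ (p t).1 (p t).2.2.1 (p t).2.2.2 (p t).2.1)
      (𝓝[>] 0) (𝓝 ((inner ℝ lbar (fderiv ℝ (fderiv ℝ F) xbar h h) : ℝ) : EReal)) := by
    have h1 := (continuous_coe_real_ereal.tendsto _).comp
      ((tendsto_const_nhds (x := lbar)).inner (tendsto_taylor_two hdiff hB ht hxy hx))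
    refine h1.congr' ?_
    filter_upwards [hx.eventually ha, hxt.eventually ha, hN, self_mem_nhdsWithin]
      with t h2 h3 h4 h5
    have h5 : 0 < t := h5
    refine Eq.trans ?_ (secondDiffQuot_comp h5 hφ.mem (hmax _ h4.1) h2 h3).symm
    -- Both endpoints lie in the normal cone, where `σ_Q` is the linear form of `lbar`, so the
    -- quotient vanishes.
    have h6 : secondDiffQuot (supportFun Q) t (F (x t)) lbar
        (t⁻¹ • (F (x t + t • t⁻¹ • (y t - x t)) - F (x t))) = 0 := by
      rw [hy t h5, secondDiffQuot, smul_inv_smul₀ h5.ne', add_sub_cancel,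
        supportFun_eq_of_forall_le hφ.mem (hmax _ h4.1),
        supportFun_eq_of_forall_le hφ.mem (hmax _ h4.2), real_inner_smul_right,
        mul_inv_cancel_left₀ h5.ne', inner_sub_right, ← EReal.coe_sub, ← EReal.coe_sub, sub_self,
        EReal.coe_zero, EReal.zero_div]
    rw [h6, zero_add]
    rfl
  rw [← hlim.liminf_eq]
  exact liminf_le_liminf_of_le hp

end Equality

end StrictChain

theorem mainTheorem3 {n m : ℕ}
    (φ : EuclideanSpace ℝ (Fin n) → EReal) (xbar : EuclideanSpace ℝ (Fin n))
    (Q : Set (EuclideanSpace ℝ (Fin m)))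
    (F : EuclideanSpace ℝ (Fin n) → EuclideanSpace ℝ (Fin m))
    (lbar : EuclideanSpace ℝ (Fin m))
    (hφ : StrictChain.IsStrictlyDecomposable 2 φ xbar Q F lbar) :
    (∀ h : EuclideanSpace ℝ (Fin n),
      StrictChain.strictSecondSubderiv φ xbar
          (ContinuousLinearMap.adjoint (fderiv ℝ F xbar) lbar) h
        ≥ StrictChain.strictSecondSubderiv (StrictChain.supportFun Q) 0 lbar
            (fderiv ℝ F xbar h)
          + ((inner ℝ lbar (fderiv ℝ (fderiv ℝ F) xbar h h) : ℝ) : EReal)) ∧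
    (∀ h : EuclideanSpace ℝ (Fin n),
      fderiv ℝ F xbar h ∈ affineSpan ℝ (StrictChain.normalCone Q lbar) →
        StrictChain.strictSecondSubderiv φ xbar
            (ContinuousLinearMap.adjoint (fderiv ℝ F xbar) lbar) h
          = StrictChain.strictSecondSubderiv (StrictChain.supportFun Q) 0 lbar
              (fderiv ℝ F xbar h)
            + ((inner ℝ lbar (fderiv ℝ (fderiv ℝ F) xbar h h) : ℝ) : EReal) ∧
        StrictChain.strictSecondSubderiv (StrictChain.supportFun Q) 0 lbar
            (fderiv ℝ F xbar h) = 0) := by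
  refine ⟨hφ.le_strictSecondSubderiv, fun h hh => ?_⟩
  have h1 := hφ.le_strictSecondSubderiv h
  have h2 := hφ.strictSecondSubderiv_le hh
  have h3 := StrictChain.strictSecondSubderiv_supportFun_nonneg hφ.nonempty lbar
    (fderiv ℝ F xbar h)
  have h4 : StrictChain.strictSecondSubderiv (StrictChain.supportFun Q) 0 lbar
      (fderiv ℝ F xbar h) = 0 := by
    refine le_antisymm ?_ h3
    -- The curvature term is finite, so it may be cancelled in `EReal`.
    have h5 := EReal.le_sub_iff_add_le (Or.inl (EReal.coe_ne_bot _))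
      (Or.inl (EReal.coe_ne_top _)) |>.2 (h1.trans h2)
    rwa [← EReal.coe_sub, sub_self, EReal.coe_zero] at h5
  refine ⟨?_, h4⟩
  rw [h4, zero_add] at h1 ⊢
  exact le_antisymm h2 h1
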